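/- Let $\Omega\subset\mathbb{R}^3$ be a bounded domain with piecewise smooth boundary, $\overline\Omega$ its closure, $\partial\Omega=\Gamma^{\vartheta}\cup\Gamma^{q}\cup\Gamma^{\mathrm N}$ a partition of the boundary into three disjoint measurable parts, and $T>0$. Let $\Sigma\subset\overline\Omega$ be a vasculature: a connected network of finitely many rectifiable curves (channels), parametrized by arc length in the flow direction with unit tangent $\widehat{\mathbf t}$, running inside $\Omega$, meeting only at nodes, with one inlet and one outlet on $\partial\Omega$ (for example a single curve from inlet to outlet). Channel $e$ carries a constant mass flow rate $\dot m_e\ge 0$, and mass is conserved at the nodes other than inlet and outlet; write $\dot m=\dot m_e$ on channel $e$. Let $\rho_s,c_s,\sigma>0$ and $c_f,h_T,\varepsilon\ge 0$ be constants, let $\mathbf K(\mathbf x)$ be a measurable, pointwise positive definite conductivity tensor, and let $\vartheta_{\mathrm{amb}},\vartheta_{\mathrm{inlet}}\in\mathbb R$, $\vartheta^{\mathrm p}$, $q^{\mathrm p}$ (integrable over $\Gamma^q$ at each time) and $\vartheta_{\mathrm{initial}}\in L^2(\Omega)$ be given. Consider the model $$\rho_s c_s\,\partial_t\vartheta+\mathrm{div}\,\mathbf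 q=0,\quad \mathbf q=-\mathbf K\,\mathrm{grad}\,\vartheta\quad\text{in }\Omega,\qquad \vartheta=\vartheta^{\mathrm p}\ \text{on }\Gamma^{\vartheta},\qquad \mathbf q\cdot\widehat{\mathbf n}=q^{\mathrm p}\ \text{on }\Gamma^{q},$$ $$\mathbf q\cdot\widehat{\mathbf n}=h_T(\vartheta-\vartheta_{\mathrm{amb}})+\varepsilon\sigma(\vartheta^4-\vartheta_{\mathrm{amb}}^4)\ \text{on }\Gamma^{\mathrm N},\qquad [\![\vartheta]\!]=0,\quad [\![\mathbf q]\!]=\dot m\,c_f\,\mathrm{grad}\,\vartheta\cdot\widehat{\mathbf t}\ \text{on }\Sigma,$$ $$\vartheta(\cdot,0)=\vartheta_{\mathrm{initial}}\ \text{in }\Omega,\qquad \vartheta=\vartheta_{\mathrm{inlet}}\ \text{at the inlet}.$$ A solution is a function $\vartheta$ such that, for every $t\in(0,T]$: $\vartheta(\cdot,t)\in H^1(\Omega)\cap C(\overline\Omega)$ with $\mathrm{grad}\,\vartheta\cdot\mathbf K\,\mathrm{grad}\,\vartheta\in L^1(\Omega)$; $\vartheta(\cdot,t)$ is absolutely continuous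 along each channel ($\mathrm{grad}\,\vartheta\cdot\widehat{\mathbf t}$ is its arc-length derivative); $\partial_t\vartheta$ exists in the sense of $L^2(\Omega)$; the conditions on $\Gamma^\vartheta$ and at the inlet hold; and $$\int_\Omega\rho_s c_s\,\xi\,\partial_t\vartheta\,\mathrm d\Omega+\int_\Omega \mathrm{grad}\,\xi\cdot\mathbf K\,\mathrm{grad}\,\vartheta\,\mathrm d\Omega+\int_\Sigma\dot m\,c_f\,\xi\,\mathrm{grad}\,\vartheta\cdot\widehat{\mathbf t}\,\mathrm d\Gamma+\int_{\Gamma^{\mathrm N}}\xi\,\big(h_T(\vartheta-\vartheta_{\mathrm{amb}})+\varepsilon\sigma(\vartheta^4-\vartheta_{\mathrm{amb}}^4)\big)\mathrm d\Gamma=-\int_{\Gamma^q}\xi\,q^{\mathrm p}\,\mathrm d\Gamma$$ for all $\xi\in H^1(\Omega)\cap C(\overline\Omega)$ with $\mathrm{grad}\,\xi\cdot\mathbf K\,\mathrm{grad}\,\xi\in L^1(\Omega)$ that vanish on $\Gamma^\vartheta$ and at the inlet, with $\mathrm{grad}\,\xi\cdot\mathbf K\,\mathrm{grad}\,\vartheta\in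 L^1(\Omega)$; moreover $\vartheta(\cdot,0)=\vartheta_{\mathrm{initial}}$ in $\Omega$ and $\vartheta(\cdot,t)\to\vartheta_{\mathrm{initial}}$ in $L^2(\Omega)$ as $t\to0^+$. **Theorem.** With radiation ($\varepsilon\ne 0$), non-negative solutions are unique: if $\vartheta_1,\vartheta_2$ are two solutions for the same data and both are $\ge 0$ in $\Omega\times[0,T]$, then $\vartheta_1=\vartheta_2$ on $\Omega\times[0,T]$ and on $\overline\Omega\times(0,T]$. -/

import Mathlib

open MeasureTheory Set Filter Topology
open scoped ENNReal ContDiff InnerProductSpace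

noncomputable section

namespace Geothermal

/-- The Euclidean plane, used for parametrizing surface patches. -/
abbrev E2 := EuclideanSpace ℝ (Fin 2)

/-- Physical space. -/
abbrev E3 := EuclideanSpace ℝ (Fin 3)

/-- The surface area measure on `ℝ³` (two-dimensional Hausdorff measure, normalized so that it
agrees with Lebesgue measure on planes). -/
def area : Measure E3 := μHE[2]

/-- The boundary of `Ω` is a finite union of compact `C¹` surface patches (each one regular and
injective on the interior of its parameter set), and `Ω` has no slits. -/
def HasPiecewiseSmoothBoundary (Ω : Set E3) : Prop :=
  interior (closure Ω) = Ω ∧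
  ∃ (n : ℕ) (φ : Fin n → E2 → E3) (P : Fin n → Set E2),
    (∀ i, ContDiff ℝ 1 (φ i)) ∧
    (∀ i, IsCompact (P i) ∧ P i ⊆ closure (interior (P i))) ∧
    (∀ i, InjOn (φ i) (interior (P i))) ∧
    (∀ i, ∀ y ∈ interior (P i), Function.Injective (fderiv ℝ (φ i) y)) ∧
    frontier Ω = ⋃ i, φ i '' P i

/-- `G` is a weak (distributional) gradient of `u` in the open set `Ω`. -/
structure HasWeakGradient (Ω : Set E3) (u : E3 → ℝ) (G : E3 → E3) : Prop where
  locallyIntegrable : LocallyIntegrableOn u Ω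
  locallyIntegrable_grad : LocallyIntegrableOn G Ω
  integral_eq : ∀ φ : E3 → ℝ, ContDiff ℝ ∞ φ → HasCompactSupport φ → tsupport φ ⊆ Ω →
    ∫ x in Ω, u x • gradient φ x = - ∫ x in Ω, φ x • G x

/-- A vasculature in `Ω`: a connected network of finitely many rectifiable curves (channels),
parametrized by arc length in the direction of the flow, that run inside `Ω` and meet only at
finitely many nodes; two of the nodes, the inlet and the outlet, lie on the boundary of `Ω`. -/
structure Vasculature (Ω : Set E3) where
  /-- number of nodes -/
  nodes : ℕ
  /-- number of channels -/
  channels : ℕ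
  pos : Fin nodes → E3
  pos_injective : Function.Injective pos
  inlet : Fin nodes
  outlet : Fin nodes
  inlet_ne_outlet : inlet ≠ outlet
  /-- upstream end of a channel -/
  src : Fin channels → Fin nodes
  /-- downstream end of a channel -/
  tgt : Fin channels → Fin nodes
  length : Fin channels → ℝ
  length_pos : ∀ e, 0 < length e
  /-- arc-length parametrization of a channel on `[0, length]` -/
  path : Fin channels → ℝ → E3
  path_unitSpeed : ∀ e, HasUnitSpeedOn (path e) (Icc 0 (length e))
  path_continuous : ∀ e, ContinuousOn (path e) (Icc 0 (length e))
  path_injOn : ∀ e, InjOn (path e) (Icc 0 (length e))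
  path_zero : ∀ e, path e 0 = pos (src e)
  path_length : ∀ e, path e (length e) = pos (tgt e)
  path_disjoint : ∀ e f, e ≠ f →
    Disjoint (path e '' Ioo 0 (length e)) (path f '' Icc 0 (length f))
  path_mem : ∀ e, ∀ s ∈ Ioo 0 (length e), path e s ∈ Ω
  pos_mem : ∀ v, v ≠ inlet → v ≠ outlet → pos v ∈ Ω
  inlet_mem : pos inlet ∈ frontier Ω
  outlet_mem : pos outlet ∈ frontier Ω
  /-- the fluid enters at the inlet and leaves at the outlet -/
  tgt_ne_inlet : ∀ e, tgt e ≠ inlet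
  src_ne_outlet : ∀ e, src e ≠ outlet
  connected : IsConnected (⋃ e, path e '' Icc 0 (length e))

/-- The data of the geothermal model, with their standing assumptions. -/
structure Model where
  /-- the host solid -/
  Ω : Set E3
  isOpen : IsOpen Ω
  isConnected : IsConnected Ω
  isBounded : Bornology.IsBounded Ω
  boundary : HasPiecewiseSmoothBoundary Ω
  /-- the part of the boundary where the temperature is prescribed -/
  Γtemp : Set E3
  /-- the part of the boundary where the heat flux is prescribed -/
  Γflux : Set E3
  /-- the part of the boundary that is free to convect and radiate -/
  Γfree : Set E3
  measurableSet_Γtemp : MeasurableSet Γtemp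
  measurableSet_Γflux : MeasurableSet Γflux
  measurableSet_Γfree : MeasurableSet Γfree
  union_eq : Γtemp ∪ Γflux ∪ Γfree = frontier Ω
  disjoint_temp_flux : Disjoint Γtemp Γflux
  disjoint_flux_free : Disjoint Γflux Γfree
  disjoint_free_temp : Disjoint Γfree Γtemp
  /-- the channels -/
  vasc : Vasculature Ω
  /-- density of the host solid -/
  ρs : ℝ
  ρs_pos : 0 < ρs
  /-- specific heat capacity of the host solid -/
  cs : ℝ
  cs_pos : 0 < cs
  /-- conductivity tensor of the host solid -/
  K : E3 → E3 →L[ℝ] E3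
  K_measurable : AEStronglyMeasurable K (volume.restrict Ω)
  K_posDef : ∀ x ∈ Ω, ∀ v : E3, v ≠ 0 → 0 < ⟪v, K x v⟫_ℝ
  /-- mass flow rate of the fluid in each channel -/
  mdot : Fin vasc.channels → ℝ
  mdot_nonneg : ∀ e, 0 ≤ mdot e
  /-- no fluid is gained or lost at the interior nodes (void if there is only one channel) -/
  mdot_conserved : ∀ v, v ≠ vasc.inlet → v ≠ vasc.outlet →
    ∑ e with vasc.tgt e = v, mdot e = ∑ e with vasc.src e = v, mdot e
  /-- specific heat capacity of the fluid -/
  cf : ℝ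
  cf_nonneg : 0 ≤ cf
  /-- heat transfer coefficient -/
  hT : ℝ
  hT_nonneg : 0 ≤ hT
  /-- emissivity -/
  ε : ℝ
  ε_nonneg : 0 ≤ ε
  /-- Stefan-Boltzmann constant -/
  σ : ℝ
  σ_pos : 0 < σ
  /-- ambient temperature -/
  θamb : ℝ
  /-- length of the time interval -/
  T : ℝ
  T_pos : 0 < T
  /-- prescribed temperature -/
  θp : ℝ → E3 → ℝ
  /-- prescribed heat flux -/
  qp : ℝ → E3 → ℝ
  qp_integrable : ∀ t ∈ Ioc 0 T, IntegrableOn (qp t) Γflux area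
  /-- initial temperature -/
  θinit : E3 → ℝ
  θinit_memLp : MemLp θinit 2 (volume.restrict Ω)
  /-- temperature at the inlet -/
  θinlet : ℝ

/-- `u` is an `H¹(Ω)` field, continuous up to the boundary, with weak gradient `G` and with finite
energy `∫ ∇u · K ∇u` (for bounded `K`, the last condition holds for every `H¹` field). -/
structure Model.IsEnergyField (M : Model) (u : E3 → ℝ) (G : E3 → E3) : Prop where
  continuousOn : ContinuousOn u (closure M.Ω)
  memLp : MemLp u 2 (volume.restrict M.Ω)
  hasWeakGradient : HasWeakGradient M.Ω u G
  memLp_grad : MemLp G 2 (volume.restrict M.Ω)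
  energy : IntegrableOn (fun x => ⟪G x, M.K x (G x)⟫_ℝ) M.Ω

/-- Test functions (with their weak gradients): energy fields that vanish on the part of the
boundary where the temperature is prescribed and at the inlet. -/
structure Model.IsTestFunction (M : Model) (ξ : E3 → ℝ) (Gξ : E3 → E3) : Prop where
  energyField : M.IsEnergyField ξ Gξ
  eq_zero : ∀ x ∈ M.Γtemp, ξ x = 0
  eq_zero_inlet : ξ (M.vasc.pos M.vasc.inlet) = 0

/-- Heat loss per unit area, by convection and radiation, at a point of temperature `θ`. -/
def Model.surfaceLoss (M : Model) (θ : ℝ) : ℝ :=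
  M.hT * (θ - M.θamb) + M.ε * M.σ * (θ ^ 4 - M.θamb ^ 4)

/-- The integral over the vasculature, with respect to arc length, of
`ṁ c_f ξ (grad u · t)`, where `t` is the unit tangent vector; `grad u · t` is the derivative of
`u` along the channel with respect to arc length. -/
def Model.channelTerm (M : Model) (ξ u : E3 → ℝ) : ℝ :=
  ∑ e, ∫ s in (0 : ℝ)..M.vasc.length e,
    M.mdot e * M.cf * ξ (M.vasc.path e s) * deriv (fun r => u (M.vasc.path e r)) s

/-- `u'` is the time derivative of `u` at the time `t`, in the sense of `L²(Ω)` (one-sided at the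
ends of `[0, T]`). -/
def Model.HasTimeDeriv (M : Model) (u : ℝ → E3 → ℝ) (u' : E3 → ℝ) (t : ℝ) : Prop :=
  MemLp u' 2 (volume.restrict M.Ω) ∧
  Tendsto (fun s => eLpNorm (fun x => (u s x - u t x) / (s - t) - u' x) 2 (volume.restrict M.Ω))
    (𝓝[Icc 0 M.T \ {t}] t) (𝓝 0)

/-- The Galerkin weak form, at the time `t`, of the balance of energy with Fourier's law, of the
flux conditions on `Γflux` and `Γfree` and of the jump condition for the flux across the
vasculature. Here `u` is the temperature at the time `t`, `G` its gradient, and `u'` its time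
derivative. -/
def Model.WeakForm (M : Model) (t : ℝ) (u u' : E3 → ℝ) (G : E3 → E3) : Prop :=
  ∀ (ξ : E3 → ℝ) (Gξ : E3 → E3), M.IsTestFunction ξ Gξ →
    IntegrableOn (fun x => ⟪Gξ x, M.K x (G x)⟫_ℝ) M.Ω ∧
    (∫ x in M.Ω, M.ρs * M.cs * ξ x * u' x)
      + (∫ x in M.Ω, ⟪Gξ x, M.K x (G x)⟫_ℝ)
      + M.channelTerm ξ u
      + (∫ x in M.Γfree, ξ x * M.surfaceLoss (u x) ∂area)
      = - ∫ x in M.Γflux, ξ x * M.qp t x ∂area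

/-- `θ` (a function of time and position) is a solution of the model on `[0, T]`. -/
structure Model.IsSolution (M : Model) (θ : ℝ → E3 → ℝ) : Prop where
  /-- initial condition -/
  init : ∀ x ∈ M.Ω, θ 0 x = M.θinit x
  /-- the initial value is attained in `L²(Ω)` -/
  tendsto_init : Tendsto (fun t => eLpNorm (fun x => θ t x - M.θinit x) 2 (volume.restrict M.Ω))
    (𝓝[Ioc 0 M.T] 0) (𝓝 0)
  /-- prescribed temperature on the boundary -/
  temp : ∀ t ∈ Ioc 0 M.T, ∀ x ∈ M.Γtemp, θ t x = M.θp t x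
  /-- prescribed temperature at the inlet -/
  inlet : ∀ t ∈ Ioc 0 M.T, θ t (M.vasc.pos M.vasc.inlet) = M.θinlet
  /-- the derivative along the channels exists (continuity across them is part of
  `IsEnergyField`) -/
  channel : ∀ t ∈ Ioc 0 M.T, ∀ e,
    AbsolutelyContinuousOnInterval (fun s => θ t (M.vasc.path e s)) 0 (M.vasc.length e)
  /-- balance of energy and flux conditions -/
  balance : ∀ t ∈ Ioc 0 M.T, ∃ (θ' : E3 → ℝ) (G : E3 → E3),
    M.HasTimeDeriv θ θ' t ∧ M.IsEnergyField (θ t) G ∧ M.WeakForm t (θ t) θ' G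

/-- `θ` is non-negative in `Ω` during `[0, T]`. -/
def Model.Nonneg (M : Model) (θ : ℝ → E3 → ℝ) : Prop :=
  ∀ t ∈ Icc 0 M.T, ∀ x ∈ M.Ω, 0 ≤ θ t x

end Geothermal

end

/-! Uniqueness is an energy estimate for the difference `w` of the two solutions. Since `w` vanishes
on `Γtemp` and at the inlet, it is an admissible test function. Put it in both weak forms and
subtract: the prescribed flux cancels, and three terms remain besides `ρs * cs * ∫ w ∂ₜw`.
Conduction is non-negative because `K` is positive. Radiation and convection are non-negative
because the loss law is increasing on `[0, ∞)`; this is where non-negativity of the temperatures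
enters (`integral_surfaceLoss_le`). The channel term has no sign pointwise, but `w w' = (w²)' / 2`
turns it into differences of `w²` at the ends of the channels. Conservation of mass cancels the
interior nodes, `w` vanishes at the inlet, and the outlet contributes with a good sign
(`channelTerm_le`). Hence `∫ w ∂ₜw ≤ 0` (`integral_mul_deriv_nonpos`), so the squared `L²` norm of
`w` decreases from its initial value zero (`eq_zero_of_inner_deriv_nonpos`). Continuity upgrades
almost everywhere equality to equality on the closure. -/

noncomputable section

namespace Geothermal

/-! ### Weak gradients, finite boundary area, and monotone norms of curves in `L²`. -/

section General

lemma HasWeakGradient.sub {Ω : Set E3} (hΩ : Bornology.IsBounded Ω) {u v : E3 → ℝ} {G H : E3 → E3}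
    (hu : HasWeakGradient Ω u G) (hv : HasWeakGradient Ω v H)
    (hu2 : MemLp u 2 (volume.restrict Ω)) (hv2 : MemLp v 2 (volume.restrict Ω))
    (hG2 : MemLp G 2 (volume.restrict Ω)) (hH2 : MemLp H 2 (volume.restrict Ω)) :
    HasWeakGradient Ω (fun x => u x - v x) (fun x => G x - H x) where
  locallyIntegrable := hu.locallyIntegrable.sub hv.locallyIntegrable
  locallyIntegrable_grad := hu.locallyIntegrable_grad.sub hv.locallyIntegrable_grad
  integral_eq := by
    intro φ hφ hφc hφΩ
    have : IsFiniteMeasure (volume.restrict Ω) :=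
      isFiniteMeasure_restrict.2 hΩ.measure_lt_top.ne
    have hgc : Continuous (gradient φ) := by
      unfold gradient
      exact (InnerProductSpace.toDual ℝ E3).symm.continuous.comp (hφ.continuous_fderiv (by simp))
    have hgs : HasCompactSupport (gradient φ) := by
      unfold gradient
      exact (hφc.fderiv (𝕜 := ℝ)).comp_left (map_zero _)
    have hg : MemLp (gradient φ) ⊤ (volume.restrict Ω) :=
      (hgc.memLp_top_of_hasCompactSupport hgs volume).restrict _
    have hf : MemLp φ ⊤ (volume.restrict Ω) :=
      (hφ.continuous.memLp_top_of_hasCompactSupport hφc volume).restrict _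
    -- `L²` times a bounded function is `L²`, hence integrable because `Ω` has finite measure.
    have ig : ∀ {f : E3 → ℝ}, MemLp f 2 (volume.restrict Ω) →
        IntegrableOn (fun x => f x • gradient φ x) Ω := fun h =>
      (hg.smul h (r := 2)).integrable (by norm_num)
    have iG : ∀ {f : E3 → E3}, MemLp f 2 (volume.restrict Ω) →
        IntegrableOn (fun x => φ x • f x) Ω := fun h =>
      (h.smul hf (r := 2)).integrable (by norm_num)
    simp_rw [sub_smul, smul_sub]
    rw [integral_sub (ig hu2) (ig hv2), integral_sub (iG hG2) (iG hH2),
      hu.integral_eq φ hφ hφc hφΩ, hv.integral_eq φ hφ hφc hφΩ]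
    abel

/-- Parallelogram identity for the quadratic form of `A`, dropping the term at `a + b`; no symmetry
of `A` is needed. It gives finite energy of a difference without any bound on `K`. -/
lemma inner_sub_apply_sub_le {A : E3 →L[ℝ] E3} (hA : ∀ v, 0 ≤ ⟪v, A v⟫_ℝ) (a b : E3) :
    ⟪a - b, A (a - b)⟫_ℝ ≤ 2 * (⟪a, A a⟫_ℝ + ⟪b, A b⟫_ℝ) := by
  have h := hA (a + b)
  simp only [map_add, map_sub, inner_add_left, inner_add_right, inner_sub_left,
    inner_sub_right] at h ⊢
  linarith

lemma aestronglyMeasurable_inner_apply {μ : Measure E3} {A : E3 → E3 →L[ℝ] E3} {a b : E3 → E3}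
    (hA : AEStronglyMeasurable A μ) (ha : AEStronglyMeasurable a μ)
    (hb : AEStronglyMeasurable b μ) :
    AEStronglyMeasurable (fun x => ⟪a x, A x (b x)⟫_ℝ) μ :=
  ha.inner (isBoundedBilinearMap_apply.continuous.comp_aestronglyMeasurable (hA.prodMk hb))

/-- A `C¹` map is Lipschitz on a compact set, and Lipschitz maps enlarge Hausdorff measure by at
most a constant factor. -/
lemma area_frontier_lt_top {Ω : Set E3} (h : HasPiecewiseSmoothBoundary Ω) :
    area (frontier Ω) < ⊤ := by
  obtain ⟨-, n, φ, P, hφ, hP, -, -, hfr⟩ := h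
  rw [hfr]
  refine (measure_iUnion_le _).trans_lt ?_
  rw [tsum_fintype]
  refine ENNReal.sum_lt_top.2 fun i _ => ?_
  obtain ⟨C, hC⟩ := LocallyLipschitzOn.exists_lipschitzOnWith_of_compact (hP i).1
    ((hφ i).locallyLipschitz.locallyLipschitzOn (s := P i))
  have hvol : μHE[2] (P i) < ⊤ := by
    rw [EuclideanSpace.euclideanHausdorffMeasure_eq_volume]
    exact (hP i).1.measure_lt_top
  have himage : μHE[2] (φ i '' P i) ≤ (C : ℝ≥0∞) ^ ((2 : ℕ) : ℝ) * μHE[2] (P i) := by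
    simp only [Measure.euclideanHausdorffMeasure_def, Measure.smul_apply, ENNReal.smul_def,
      smul_eq_mul]
    rw [mul_left_comm]
    exact mul_le_mul_right (hC.hausdorffMeasure_image_le (Nat.cast_nonneg 2)) _
  exact himage.trans_lt (ENNReal.mul_lt_top
    (ENNReal.rpow_lt_top_of_nonneg (Nat.cast_nonneg 2) ENNReal.coe_ne_top) hvol)

/-- If the curve `u`, continuous into `L²` on `[0, T]` and zero at `0`, satisfies `⟪u, u'⟫ ≤ 0`, it
vanishes. -/
lemma eq_zero_of_inner_deriv_nonpos {F : Type*} [NormedAddCommGroup F] [InnerProductSpace ℝ F]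
    {T : ℝ} {W W' : ℝ → F} (h0 : W 0 = 0) (hc : Tendsto W (𝓝[Ioc 0 T] 0) (𝓝 0))
    (hd : ∀ t ∈ Ioc 0 T, HasDerivWithinAt W (W' t) (Ioc 0 T) t)
    (hneg : ∀ t ∈ Ioc 0 T, ⟪W t, W' t⟫_ℝ ≤ 0) {t : ℝ} (ht : t ∈ Icc 0 T) : W t = 0 := by
  have hE : ∀ s ∈ Ioo 0 T, HasDerivAt (fun r => ‖W r‖ ^ 2) (2 * ⟪W s, W' s⟫_ℝ) s := fun s hs =>
    ((hd s (Ioo_subset_Ioc_self hs)).hasDerivAt (Ioc_mem_nhds hs.1 hs.2)).norm_sq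
  have hcont : ContinuousOn W (Icc 0 T) := by
    intro s hs
    -- Continuity at `0` is the assumed limit; at every other time it follows from
    -- differentiability.
    rw [← Ioc_insert_left (hs.1.trans hs.2)]
    rcases hs.1.eq_or_lt with rfl | hs0
    · rw [continuousWithinAt_insert_self, ContinuousWithinAt, h0]
      exact hc
    · rw [continuousWithinAt_insert]
      exact (hd s ⟨hs0, hs.2⟩).continuousWithinAt
  have hanti : AntitoneOn (fun r => ‖W r‖ ^ 2) (Icc 0 T) := by
    refine antitoneOn_of_deriv_nonpos (convex_Icc 0 T) (hcont.norm.pow 2) ?_ ?_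
    · rw [interior_Icc]
      exact fun s hs => (hE s hs).differentiableAt.differentiableWithinAt
    · rw [interior_Icc]
      intro s hs
      rw [(hE s hs).deriv]
      linarith [hneg s (Ioo_subset_Ioc_self hs)]
  have := hanti ⟨le_rfl, ht.1.trans ht.2⟩ ht ht.1
  simp only [h0, norm_zero] at this
  have h3 : ‖W t‖ ^ 2 = 0 := le_antisymm (by simpa using this) (sq_nonneg _)
  simpa using h3

/-- A derivative in the sense of `L²` seminorms is a derivative in the space `L²`. -/
lemma hasDerivWithinAt_toLp {α : Type*} [MeasurableSpace α] {μ : Measure α} {w : ℝ → α → ℝ}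
    {w' : α → ℝ} {W : ℝ → Lp ℝ 2 μ} {S : Set ℝ} {t : ℝ} (ht : t ∈ S)
    (hW : ∀ s ∈ S, W s =ᵐ[μ] w s) (hw' : MemLp w' 2 μ)
    (h : Tendsto (fun s => eLpNorm (fun x => (w s x - w t x) / (s - t) - w' x) 2 μ)
      (𝓝[S \ {t}] t) (𝓝 0)) :
    HasDerivWithinAt W (hw'.toLp w') S t := by
  rw [hasDerivWithinAt_iff_tendsto_slope, tendsto_iff_edist_tendsto_0]
  refine h.congr' ?_
  filter_upwards [self_mem_nhdsWithin] with s hs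
  rw [Lp.edist_def]
  refine eLpNorm_congr_ae ?_
  have h1 : (slope W t s : Lp ℝ 2 μ) =ᵐ[μ] fun x => (w s x - w t x) / (s - t) := by
    rw [slope_def_module]
    filter_upwards [Lp.coeFn_smul (s - t)⁻¹ (W s - W t), Lp.coeFn_sub (W s) (W t), hW s hs.1,
      hW t ht] with x h1 h2 h3 h4
    rw [h1, Pi.smul_apply, h2, Pi.sub_apply, h3, h4, smul_eq_mul, div_eq_inv_mul]
  filter_upwards [h1, hw'.coeFn_toLp] with x h1 h2
  rw [Pi.sub_apply, h1, h2]

end General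

/-! ### Energy fields and the sign of the surface term. -/

namespace Model

variable {M : Model} {u v : E3 → ℝ} {G H : E3 → E3}

lemma K_nonneg (M : Model) {x : E3} (hx : x ∈ M.Ω) (a : E3) : 0 ≤ ⟪a, M.K x a⟫_ℝ := by
  by_cases h : a = 0
  · simp [h]
  · exact (M.K_posDef x hx a h).le

lemma IsEnergyField.sub (hu : M.IsEnergyField u G) (hv : M.IsEnergyField v H) :
    M.IsEnergyField (fun x => u x - v x) (fun x => G x - H x) where
  continuousOn := hu.continuousOn.sub hv.continuousOn
  memLp := hu.memLp.sub hv.memLp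
  hasWeakGradient := hu.hasWeakGradient.sub M.isBounded hv.hasWeakGradient hu.memLp hv.memLp
    hu.memLp_grad hv.memLp_grad
  memLp_grad := hu.memLp_grad.sub hv.memLp_grad
  energy := by
    refine Integrable.mono' ((hu.energy.add hv.energy).const_mul 2)
      (aestronglyMeasurable_inner_apply M.K_measurable
        (hu.memLp_grad.sub hv.memLp_grad).1 (hu.memLp_grad.sub hv.memLp_grad).1) ?_
    filter_upwards [ae_restrict_mem M.isOpen.measurableSet] with x hx
    rw [Real.norm_of_nonneg (M.K_nonneg hx _)]
    exact inner_sub_apply_sub_le (M.K_nonneg hx) _ _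

lemma surfaceLoss_monotoneOn (M : Model) : MonotoneOn M.surfaceLoss (Ici 0) := by
  intro a ha b _ hab
  have h4 : a ^ 4 ≤ b ^ 4 := pow_le_pow_left₀ ha hab 4
  have := mul_le_mul_of_nonneg_left (sub_le_sub_right hab M.θamb) M.hT_nonneg
  have := mul_le_mul_of_nonneg_left (sub_le_sub_right h4 (M.θamb ^ 4))
    (mul_nonneg M.ε_nonneg M.σ_pos.le)
  unfold surfaceLoss
  linarith

lemma continuous_surfaceLoss (M : Model) : Continuous M.surfaceLoss := by
  unfold surfaceLoss
  fun_prop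

lemma Γfree_subset (M : Model) : M.Γfree ⊆ frontier M.Ω := by
  rw [← M.union_eq]
  exact subset_union_right

lemma isCompact_closure (M : Model) : IsCompact (closure M.Ω) :=
  M.isBounded.isCompact_closure

lemma integrableOn_Γfree (M : Model) {f : E3 → ℝ} (hf : ContinuousOn f (closure M.Ω)) :
    IntegrableOn f M.Γfree area := by
  obtain ⟨C, hC⟩ := M.isCompact_closure.exists_bound_of_continuousOn hf
  have hsub : M.Γfree ⊆ closure M.Ω := M.Γfree_subset.trans frontier_subset_closure
  refine IntegrableOn.of_bound ((measure_mono M.Γfree_subset).trans_lt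
    (area_frontier_lt_top M.boundary))
    ((hf.mono hsub).aestronglyMeasurable M.measurableSet_Γfree) C ?_
  filter_upwards [ae_restrict_mem M.measurableSet_Γfree] with x hx
  exact hC x (hsub hx)

/-- The heat loss at the surface is monotone in the temperature. -/
lemma integral_surfaceLoss_le (M : Model) (hu : ContinuousOn u (closure M.Ω))
    (hv : ContinuousOn v (closure M.Ω)) (hu0 : ∀ x ∈ closure M.Ω, 0 ≤ u x)
    (hv0 : ∀ x ∈ closure M.Ω, 0 ≤ v x) :
    ∫ x in M.Γfree, (u x - v x) * M.surfaceLoss (v x) ∂area ≤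
      ∫ x in M.Γfree, (u x - v x) * M.surfaceLoss (u x) ∂area := by
  refine setIntegral_mono_on
    (M.integrableOn_Γfree ((hu.sub hv).mul (M.continuous_surfaceLoss.comp_continuousOn hv)))
    (M.integrableOn_Γfree ((hu.sub hv).mul (M.continuous_surfaceLoss.comp_continuousOn hu)))
    M.measurableSet_Γfree fun x hx => ?_
  have hx' : x ∈ closure M.Ω := frontier_subset_closure (M.Γfree_subset hx)
  -- The temperature difference and the difference of losses have the same sign.
  rcases le_total (u x) (v x) with h | h
  · exact mul_le_mul_of_nonpos_left
      (M.surfaceLoss_monotoneOn (hu0 x hx') (hv0 x hx') h) (sub_nonpos.2 h)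
  · exact mul_le_mul_of_nonneg_left
      (M.surfaceLoss_monotoneOn (hv0 x hx') (hu0 x hx') h) (sub_nonneg.2 h)

/-! ### Transport along the network and the energy estimate. -/

/-- By conservation of mass, a nodal quantity that vanishes at the inlet is transported out of
the network at a non-negative rate if it is non-negative. -/
lemma sum_mdot_mul_nonneg (M : Model) {g : Fin M.vasc.nodes → ℝ} (hg : ∀ v, 0 ≤ g v)
    (hin : g M.vasc.inlet = 0) :
    0 ≤ ∑ e, M.mdot e * (g (M.vasc.tgt e) - g (M.vasc.src e)) := by
  -- Regroup a sum over channels by end node, so that each `g v` is weighted by inflow minus outflow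
  -- at `v`.
  have key : ∀ f : Fin M.vasc.channels → Fin M.vasc.nodes,
      ∑ e, M.mdot e * g (f e) = ∑ v, (∑ e with f e = v, M.mdot e) * g v := by
    intro f
    rw [← Finset.sum_fiberwise Finset.univ f]
    refine Finset.sum_congr rfl fun v _ => ?_
    rw [Finset.sum_mul]
    refine Finset.sum_congr rfl fun e he => ?_
    rw [(Finset.mem_filter.1 he).2]
  simp_rw [mul_sub]
  rw [Finset.sum_sub_distrib, key, key, ← Finset.sum_sub_distrib]
  refine Finset.sum_nonneg fun v _ => ?_
  by_cases h1 : v = M.vasc.inlet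
  · simp [h1, hin]
  by_cases h2 : v = M.vasc.outlet
  · have : ∑ e with M.vasc.src e = v, M.mdot e = 0 := by
      rw [Finset.filter_false_of_mem fun e _ => h2 ▸ M.vasc.src_ne_outlet e, Finset.sum_empty]
    rw [this, zero_mul, sub_zero]
    exact mul_nonneg (Finset.sum_nonneg fun e _ => M.mdot_nonneg e) (hg v)
  · rw [M.mdot_conserved v h1 h2, sub_self]

/-- Since `mdot e` is constant on a channel, the integrand is a multiple of `(w²)'` with `w = u -
v`; absolute continuity justifies the fundamental theorem of calculus. -/
lemma channelTerm_sub_sub (M : Model)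
    (hu : ∀ e, AbsolutelyContinuousOnInterval (fun s => u (M.vasc.path e s)) 0 (M.vasc.length e))
    (hv : ∀ e, AbsolutelyContinuousOnInterval (fun s => v (M.vasc.path e s)) 0
      (M.vasc.length e)) :
    M.channelTerm (fun x => u x - v x) u - M.channelTerm (fun x => u x - v x) v =
      M.cf / 2 * ∑ e, M.mdot e * ((u (M.vasc.pos (M.vasc.tgt e)) - v (M.vasc.pos (M.vasc.tgt e))) ^ 2
        - (u (M.vasc.pos (M.vasc.src e)) - v (M.vasc.pos (M.vasc.src e))) ^ 2) := by
  unfold channelTerm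
  rw [← Finset.sum_sub_distrib, Finset.mul_sum]
  refine Finset.sum_congr rfl fun e _ => ?_
  have hw := (hu e).fun_sub (hv e)
  have hI := hw.integral_deriv_mul_eq_sub hw
  have hcont : ContinuousOn (fun s => M.mdot e * M.cf *
      (u (M.vasc.path e s) - v (M.vasc.path e s))) (uIcc 0 (M.vasc.length e)) :=
    hw.continuousOn.const_smul (M.mdot e * M.cf)
  beta_reduce
  rw [← intervalIntegral.integral_sub ((hu e).intervalIntegrable_deriv.continuousOn_mul hcont)
    ((hv e).intervalIntegrable_deriv.continuousOn_mul hcont)]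
  have : ∫ s in (0 : ℝ)..M.vasc.length e,
      (M.mdot e * M.cf * (u (M.vasc.path e s) - v (M.vasc.path e s)) *
          deriv (fun r => u (M.vasc.path e r)) s
        - M.mdot e * M.cf * (u (M.vasc.path e s) - v (M.vasc.path e s)) *
          deriv (fun r => v (M.vasc.path e r)) s) =
      ∫ s in (0 : ℝ)..M.vasc.length e, M.mdot e * M.cf / 2 *
        (deriv (fun r => u (M.vasc.path e r) - v (M.vasc.path e r)) s *
            (u (M.vasc.path e s) - v (M.vasc.path e s))
          + (u (M.vasc.path e s) - v (M.vasc.path e s)) *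
            deriv (fun r => u (M.vasc.path e r) - v (M.vasc.path e r)) s) := by
    refine intervalIntegral.integral_congr_ae ?_
    filter_upwards [(hu e).ae_differentiableAt, (hv e).ae_differentiableAt] with s h1 h2 hs
    rw [deriv_fun_sub (h1 (uIoc_subset_uIcc hs)) (h2 (uIoc_subset_uIcc hs))]
    ring
  rw [this, intervalIntegral.integral_const_mul, hI, M.vasc.path_zero, M.vasc.path_length]
  ring

lemma channelTerm_le (M : Model)
    (hu : ∀ e, AbsolutelyContinuousOnInterval (fun s => u (M.vasc.path e s)) 0 (M.vasc.length e))
    (hv : ∀ e, AbsolutelyContinuousOnInterval (fun s => v (M.vasc.path e s)) 0 (M.vasc.length e))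
    (hin : u (M.vasc.pos M.vasc.inlet) = v (M.vasc.pos M.vasc.inlet)) :
    M.channelTerm (fun x => u x - v x) v ≤ M.channelTerm (fun x => u x - v x) u := by
  rw [← sub_nonneg, M.channelTerm_sub_sub hu hv]
  exact mul_nonneg (div_nonneg M.cf_nonneg zero_le_two)
    (M.sum_mdot_mul_nonneg (g := fun n => (u (M.vasc.pos n) - v (M.vasc.pos n)) ^ 2)
      (fun _ => sq_nonneg _) (by simp [hin]))

/-- The energy estimate for the difference of two solutions at a fixed time. -/
lemma integral_mul_deriv_nonpos {t : ℝ} {u' v' : E3 → ℝ} (hu : M.IsEnergyField u G)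
    (hv : M.IsEnergyField v H) (hu' : MemLp u' 2 (volume.restrict M.Ω))
    (hv' : MemLp v' 2 (volume.restrict M.Ω))
    (hcu : ∀ e, AbsolutelyContinuousOnInterval (fun s => u (M.vasc.path e s)) 0 (M.vasc.length e))
    (hcv : ∀ e, AbsolutelyContinuousOnInterval (fun s => v (M.vasc.path e s)) 0
      (M.vasc.length e))
    (htemp : ∀ x ∈ M.Γtemp, u x = v x)
    (hin : u (M.vasc.pos M.vasc.inlet) = v (M.vasc.pos M.vasc.inlet))
    (hwu : M.WeakForm t u u' G) (hwv : M.WeakForm t v v' H)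
    (hu0 : ∀ x ∈ closure M.Ω, 0 ≤ u x) (hv0 : ∀ x ∈ closure M.Ω, 0 ≤ v x) :
    ∫ x in M.Ω, (u x - v x) * (u' x - v' x) ≤ 0 := by
  have htest : M.IsTestFunction (fun x => u x - v x) (fun x => G x - H x) :=
    ⟨hu.sub hv, fun x hx => sub_eq_zero.2 (htemp x hx), sub_eq_zero.2 hin⟩
  obtain ⟨i1, e1⟩ := hwu _ _ htest
  obtain ⟨i2, e2⟩ := hwv _ _ htest
  have hch := M.channelTerm_le hcu hcv hin
  have hsf := M.integral_surfaceLoss_le hu.continuousOn hv.continuousOn hu0 hv0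
  have hK : 0 ≤ (∫ x in M.Ω, ⟪G x - H x, M.K x (G x)⟫_ℝ)
      - ∫ x in M.Ω, ⟪G x - H x, M.K x (H x)⟫_ℝ := by
    rw [← integral_sub i1 i2]
    refine setIntegral_nonneg M.isOpen.measurableSet fun x hx => ?_
    rw [← inner_sub_right, ← map_sub]
    exact M.K_nonneg hx _
  have hint : ∀ {f : E3 → ℝ}, MemLp f 2 (volume.restrict M.Ω) →
      IntegrableOn (fun x => M.ρs * M.cs * (u x - v x) * f x) M.Ω := fun hf => by
    simp_rw [mul_assoc (M.ρs * M.cs)]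
    exact ((hu.memLp.sub hv.memLp).integrable_mul hf).const_mul _
  have hL : (∫ x in M.Ω, M.ρs * M.cs * (u x - v x) * u' x)
      - ∫ x in M.Ω, M.ρs * M.cs * (u x - v x) * v' x =
      M.ρs * M.cs * ∫ x in M.Ω, (u x - v x) * (u' x - v' x) := by
    rw [← integral_sub (hint hu') (hint hv'), ← integral_const_mul]
    refine integral_congr_ae (.of_forall fun x => ?_)
    ring
  have hpos := mul_pos M.ρs_pos M.cs_pos
  refine nonpos_of_mul_nonpos_right ?_ hpos
  -- The right-hand sides of `e1` and `e2` are equal, so their difference balances `hL` against the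
  -- non-negative terms of `hK`, `hch` and `hsf`.
  linarith

lemma HasTimeDeriv.sub {t : ℝ} {θ₁ θ₂ : ℝ → E3 → ℝ} {u' v' : E3 → ℝ}
    (ht : t ∈ Ioc 0 M.T)
    (hm₁ : ∀ s ∈ Ioc 0 M.T, AEStronglyMeasurable (θ₁ s) (volume.restrict M.Ω))
    (hm₂ : ∀ s ∈ Ioc 0 M.T, AEStronglyMeasurable (θ₂ s) (volume.restrict M.Ω))
    (h₁ : M.HasTimeDeriv θ₁ u' t) (h₂ : M.HasTimeDeriv θ₂ v' t) :
    Tendsto (fun s => eLpNorm (fun x => ((θ₁ s x - θ₂ s x) - (θ₁ t x - θ₂ t x)) / (s - t)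
      - (u' x - v' x)) 2 (volume.restrict M.Ω)) (𝓝[Ioc 0 M.T \ {t}] t) (𝓝 0) := by
  have hle : 𝓝[Ioc 0 M.T \ {t}] t ≤ 𝓝[Icc 0 M.T \ {t}] t :=
    nhdsWithin_mono _ (sdiff_subset_sdiff_left Ioc_subset_Icc_self)
  have hsum := (h₁.2.mono_left hle).add (h₂.2.mono_left hle)
  rw [add_zero] at hsum
  refine tendsto_of_tendsto_of_tendsto_of_le_of_le' tendsto_const_nhds hsum
    (.of_forall fun _ => zero_le) ?_
  filter_upwards [self_mem_nhdsWithin] with s hs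
  refine le_of_eq_of_le ?_ (eLpNorm_sub_le
    ((((hm₁ s hs.1).sub (hm₁ t ht)).mul_const (s - t)⁻¹).sub h₁.1.1)
    ((((hm₂ s hs.1).sub (hm₂ t ht)).mul_const (s - t)⁻¹).sub h₂.1.1) (by norm_num))
  congr 1
  funext x
  simp only [Pi.sub_apply]
  ring

/-! ### From the energy estimate to uniqueness. -/

variable {θ₁ θ₂ : ℝ → E3 → ℝ}

lemma IsSolution.continuousOn (h : M.IsSolution θ₁) {t : ℝ} (ht : t ∈ Ioc 0 M.T) :
    ContinuousOn (θ₁ t) (closure M.Ω) := by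
  obtain ⟨_, _, _, h, _⟩ := h.balance t ht
  exact h.continuousOn

lemma IsSolution.memLp (h : M.IsSolution θ₁) {t : ℝ} (ht : t ∈ Ioc 0 M.T) :
    MemLp (θ₁ t) 2 (volume.restrict M.Ω) := by
  obtain ⟨_, _, _, h, _⟩ := h.balance t ht
  exact h.memLp

/-- Radiation acts on the boundary, whereas non-negativity is assumed only inside `Ω`; continuity
bridges the gap. -/
lemma Nonneg.nonneg_closure (hn : M.Nonneg θ₁) (h : M.IsSolution θ₁) {t : ℝ}
    (ht : t ∈ Ioc 0 M.T) : ∀ x ∈ closure M.Ω, 0 ≤ θ₁ t x := fun _ hx =>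
  le_on_closure (f := fun _ => (0 : ℝ)) (fun y hy => hn t (Ioc_subset_Icc_self ht) y hy)
    continuousOn_const (h.continuousOn ht) hx

lemma IsSolution.tendsto_sub (h₁ : M.IsSolution θ₁) (h₂ : M.IsSolution θ₂) :
    Tendsto (fun t => eLpNorm (fun x => θ₁ t x - θ₂ t x) 2 (volume.restrict M.Ω))
      (𝓝[Ioc 0 M.T] 0) (𝓝 0) := by
  have hsum := h₁.tendsto_init.add h₂.tendsto_init
  rw [add_zero] at hsum
  refine tendsto_of_tendsto_of_tendsto_of_le_of_le' tendsto_const_nhds hsum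
    (.of_forall fun _ => zero_le) ?_
  filter_upwards [self_mem_nhdsWithin] with s hs
  refine le_of_eq_of_le ?_ (eLpNorm_sub_le ((h₁.memLp hs).sub M.θinit_memLp).1
    ((h₂.memLp hs).sub M.θinit_memLp).1 (by norm_num))
  congr 1
  funext x
  simp

lemma IsSolution.ae_eq (h₁ : M.IsSolution θ₁) (h₂ : M.IsSolution θ₂) (hn₁ : M.Nonneg θ₁)
    (hn₂ : M.Nonneg θ₂) {t : ℝ} (ht : t ∈ Ioc 0 M.T) :
    θ₁ t =ᵐ[volume.restrict M.Ω] θ₂ t := by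
  choose! u' G hu' hG hwu using h₁.balance
  choose! v' H hv' hH hwv using h₂.balance
  have hm : ∀ s ∈ Ioc 0 M.T, MemLp (fun x => θ₁ s x - θ₂ s x) 2 (volume.restrict M.Ω) :=
    fun s hs => (h₁.memLp hs).sub (h₂.memLp hs)
  have hm' : ∀ s ∈ Ioc 0 M.T, MemLp (fun x => u' s x - v' s x) 2 (volume.restrict M.Ω) :=
    fun s hs => (hu' s hs).1.sub (hv' s hs).1
  classical
  -- The default value `0` is also the right one at time `0`, where the solutions share their
  -- initial value.
  let W : ℝ → Lp ℝ 2 (volume.restrict M.Ω) := fun s =>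
    if hs : s ∈ Ioc 0 M.T then (hm s hs).toLp _ else 0
  let W' : ℝ → Lp ℝ 2 (volume.restrict M.Ω) := fun s =>
    if hs : s ∈ Ioc 0 M.T then (hm' s hs).toLp _ else 0
  have hW : ∀ s (hs : s ∈ Ioc 0 M.T), W s = (hm s hs).toLp _ := fun s hs => dif_pos hs
  have hW' : ∀ s (hs : s ∈ Ioc 0 M.T), W' s = (hm' s hs).toLp _ := fun s hs => dif_pos hs
  have hWae : ∀ s ∈ Ioc 0 M.T, W s =ᵐ[volume.restrict M.Ω] fun x => θ₁ s x - θ₂ s x :=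
    fun s hs => hW s hs ▸ (hm s hs).coeFn_toLp
  have hzero : W t = 0 := by
    refine eq_zero_of_inner_deriv_nonpos (W' := W') (T := M.T) (dif_neg (by simp)) ?_ ?_ ?_
      (Ioc_subset_Icc_self ht)
    · rw [tendsto_iff_edist_tendsto_0]
      refine (h₁.tendsto_sub h₂).congr' ?_
      filter_upwards [self_mem_nhdsWithin] with s hs
      rw [edist_zero_right, Lp.enorm_def]
      exact (eLpNorm_congr_ae (hWae s hs)).symm
    · intro s hs
      rw [hW' s hs]
      exact hasDerivWithinAt_toLp hs hWae (hm' s hs)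
        (HasTimeDeriv.sub hs (fun r hr => (h₁.memLp hr).1) (fun r hr => (h₂.memLp hr).1)
          (hu' s hs) (hv' s hs))
    · intro s hs
      rw [L2.inner_def]
      refine le_of_eq_of_le (integral_congr_ae ?_) (integral_mul_deriv_nonpos (hG s hs) (hH s hs)
        (hu' s hs).1 (hv' s hs).1 (h₁.channel s hs) (h₂.channel s hs)
        (fun x hx => (h₁.temp s hs x hx).trans (h₂.temp s hs x hx).symm)
        ((h₁.inlet s hs).trans (h₂.inlet s hs).symm) (hwu s hs) (hwv s hs)
        (hn₁.nonneg_closure h₁ hs) (hn₂.nonneg_closure h₂ hs))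
      rw [hW' s hs]
      filter_upwards [hWae s hs, (hm' s hs).coeFn_toLp] with x hx hx'
      rw [hx, hx', real_inner_eq_re_inner]
      simp [mul_comm]
  have := hWae t ht
  rw [hzero] at this
  filter_upwards [this, Lp.coeFn_zero ℝ 2 (volume.restrict M.Ω)] with x hx hx0
  rw [hx0] at hx
  exact (sub_eq_zero.1 hx.symm)

lemma IsSolution.eqOn_closure (h₁ : M.IsSolution θ₁) (h₂ : M.IsSolution θ₂) (hn₁ : M.Nonneg θ₁)
    (hn₂ : M.Nonneg θ₂) {t : ℝ} (ht : t ∈ Ioc 0 M.T) : EqOn (θ₁ t) (θ₂ t) (closure M.Ω) :=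
  (Measure.eqOn_open_of_ae_eq (h₁.ae_eq h₂ hn₁ hn₂ ht) M.isOpen
    ((h₁.continuousOn ht).mono subset_closure)
    ((h₂.continuousOn ht).mono subset_closure)).of_subset_closure
    (h₁.continuousOn ht) (h₂.continuousOn ht) subset_closure subset_rfl

end Model

end Geothermal

end

theorem theorem2 (M : Geothermal.Model) (hε : M.ε ≠ 0) (θ₁ θ₂ : ℝ → Geothermal.E3 → ℝ)
    (h₁ : M.IsSolution θ₁) (h₂ : M.IsSolution θ₂)
    (hθ₁ : M.Nonneg θ₁) (hθ₂ : M.Nonneg θ₂) :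
    (∀ t ∈ Set.Icc 0 M.T, ∀ x ∈ M.Ω, θ₁ t x = θ₂ t x) ∧
    (∀ t ∈ Set.Ioc 0 M.T, ∀ x ∈ closure M.Ω, θ₁ t x = θ₂ t x) := by
  have hpos : ∀ t ∈ Set.Ioc 0 M.T, ∀ x ∈ closure M.Ω, θ₁ t x = θ₂ t x := fun t ht x hx =>
    h₁.eqOn_closure h₂ hθ₁ hθ₂ ht hx
  refine ⟨fun t ht x hx => ?_, hpos⟩
  -- At time `0` only the initial condition in `Ω` is available, hence no claim on the closure.
  rcases ht.1.eq_or_lt with rfl | h0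
  · rw [h₁.init x hx, h₂.init x hx]
  · exact hpos t ⟨h0, ht.2⟩ x (subset_closure hx)
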